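/- All digraphs are finite, without loops and without parallel arcs. A digraph is semicomplete if any two distinct vertices are joined by at least one arc (2-cycles are allowed); it is strong if every vertex can be reached from every other vertex by a directed path; it is $k$-arc-strong if deleting any set of at most $k-1$ arcs leaves a strong digraph. A digraph is eulerian if its underlying undirected graph is connected and every vertex has in-degree equal to its out-degree; a subdigraph is spanning if it contains all vertices. Then: (a) For every $2$-arc-strong semicomplete digraph $D$ and every arc $a$ of $D$, there is a spanning eulerian subdigraph of $D$ that does not contain $a$. (b) For every $3$-arc-strong semicomplete digraph $D$ and every set $\{a,b\}$ of two distinct arcs of $D$, there is a spanning eulerian subdigraph of $D$ that contains neither $a$ nor $b$. (c) Let $f(k)$ denote the least non-negative integer $s$ such that, for every $s$-arc-strong semicomplete digraph $D$ and every set $F$ of exactly $k$ arcs of $D$, $D$ has a spanning eulerian subdigraph containing no arc of $F$. Then $f(1)=2$ and $f(2)=3$. -/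

import Mathlib

universe u

namespace Digraph

/-- The arc set of a digraph. -/
def arcs {V : Type u} (D : Digraph V) : Set (V × V) := {a | D.Adj a.1 a.2}

/-- The digraph obtained from `D` by deleting the arcs in `F` (and keeping all vertices). -/
def deleteArcs {V : Type u} (D : Digraph V) (F : Set (V × V)) : Digraph V where
  Adj x y := D.Adj x y ∧ (x, y) ∉ F

/-- A digraph without loops in which any two distinct vertices are adjacent, in at least one
direction. Parallel arcs are excluded by the type `Digraph`; 2-cycles are allowed. -/
structure IsSemicomplete {V : Type u} (D : Digraph V) : Prop where
  loopless : ∀ v, ¬ D.Adj v v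
  adjacent : ∀ x y, x ≠ y → D.Adj x y ∨ D.Adj y x

/-- Every vertex can be reached from every vertex by a directed path. -/
def IsStrong {V : Type u} (D : Digraph V) : Prop :=
  ∀ s t : V, Relation.ReflTransGen D.Adj s t

/-- `D` is `k`-arc-strong: deleting any at most `k - 1` arcs leaves a strong digraph. -/
def IsArcStrong {V : Type u} (D : Digraph V) (k : ℕ) : Prop :=
  ∀ F : Finset (V × V), (F : Set (V × V)) ⊆ D.arcs → F.card < k →
    (D.deleteArcs (F : Set (V × V))).IsStrong

/-- The out-degree of a vertex (used for finite digraphs only). -/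
noncomputable def outDeg {V : Type u} (D : Digraph V) (v : V) : ℕ := {w | D.Adj v w}.ncard

/-- The in-degree of a vertex (used for finite digraphs only). -/
noncomputable def inDeg {V : Type u} (D : Digraph V) (v : V) : ℕ := {w | D.Adj w v}.ncard

/-- A digraph is eulerian if its underlying undirected graph is connected and every vertex has
equal in- and out-degree. -/
structure IsEulerian {V : Type u} (D : Digraph V) : Prop where
  connected : D.toSimpleGraphInclusive.Connected
  balanced : ∀ v, D.inDeg v = D.outDeg v

/-- `D` has a spanning eulerian subdigraph that contains none of the arcs in `F`. A spanning
subdigraph of `D` is a digraph on the same vertices whose arcs are arcs of `D`. -/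
def HasSpanningEulerianAvoiding {V : Type u} (D : Digraph V) (F : Set (V × V)) : Prop :=
  ∃ H : Digraph V, H ≤ D ∧ H.IsEulerian ∧ Disjoint H.arcs F

/-- Every `s`-arc-strong semicomplete finite digraph has, for every set of `k` of its arcs, a
spanning eulerian subdigraph avoiding these `k` arcs. -/
def ArcStrongForcesAvoiding (k s : ℕ) : Prop :=
  ∀ (V : Type u) [Finite V] (D : Digraph V), D.IsSemicomplete → D.IsArcStrong s →
    ∀ F : Finset (V × V), (F : Set (V × V)) ⊆ D.arcs → F.card = k →
      D.HasSpanningEulerianAvoiding (F : Set (V × V))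

end Digraph

/-!
Let `D` be a semicomplete `(k + 1)`-arc-strong digraph, `F` a set of `k ≤ 2` of its arcs and `A`
the set of the remaining arcs. Then `A` is strong and at most two pairs of vertices are
nonadjacent in `A`. A spanning eulerian subdigraph in `A` is found in two steps.

*Factors.* A factor is a balanced subset of `A` without isolated vertices. By Hall's theorem,
applied to a bipartite graph whose perfect matchings are the factors (`exists_isFactor`), a factor
exists as soon as `#Y` arcs run from `R ∪ Y` to the complement of `R`, for all disjoint `R` and
`Y`. After moving vertices out of `Y`, one may assume that `Y` is independent and has no arcs from
`R` or to the rest; then at least `#Y - 1` arcs of `F` lie inside `Y`, so at most `k + 1 - #Y` of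
the at least `k + 1` arcs of `D` leaving `R` are missing from `A` (`card_le_card_cut`).

*Merging.* Take a factor `H` whose connectivity relation is maximal. Components of `H` can be
merged by adding a closed trail of unused arcs (`no_two_cycle`, `no_three_cycle`,
`no_four_cycle`), by inserting a vertex into an arc of another component (`no_insert`), or by
crossing two arcs (`no_swap`), so none of these moves is available. Consequently all arcs between
two components have the same direction (`oriented`). The delicate case is a component `{y, z}`
both of whose vertices are nonadjacent to the same vertex `x`. There the rest of the component of
`x` splits into a part dominating `{y, z}` and a part dominated by it, and since one of these
parts has two arcs to or from `x` in `H`, some passage of `H` through `x` can be rerouted through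
`y` (`no_hub`). So the components form a tournament; it is transitive because a cyclic triple
would yield a triangle of unused arcs, and strong connectivity of `A` leaves only one component
(`IsMaxFactor.conn`).

For the lower bounds, in the complete digraph on `k + 1` vertices, which is `k`-arc-strong, all
arcs leaving some vertex are forbidden.
-/

namespace SpanningEulerian

open Finset

variable {V : Type u} {A H : Finset (V × V)}

/-! ### Balanced arc sets -/

/-- Two vertices are joined by a walk of arcs of `H`, irrespective of the orientation. -/
def Conn (H : Finset (V × V)) : V → V → Prop := Relation.EqvGen fun u v => (u, v) ∈ H

lemma Conn.refl (u : V) : Conn H u u := Relation.EqvGen.refl u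

lemma Conn.symm {u v : V} (h : Conn H u v) : Conn H v u := Relation.EqvGen.symm _ _ h

lemma Conn.trans {u v w : V} (h : Conn H u v) (h' : Conn H v w) : Conn H u w :=
  Relation.EqvGen.trans _ _ _ h h'

lemma conn_of_mem {u v : V} (h : (u, v) ∈ H) : Conn H u v := Relation.EqvGen.rel _ _ h

lemma Conn.mono_of {H' : Finset (V × V)} (hH : ∀ u v, (u, v) ∈ H → Conn H' u v) {u v : V}
    (h : Conn H u v) : Conn H' u v := by
  induction h with
  | rel _ _ h => exact hH _ _ h
  | refl _ => exact Conn.refl _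
  | symm _ _ _ ih => exact ih.symm
  | trans _ _ _ _ _ ih ih' => exact ih.trans ih'

lemma Conn.mem_iff {S : Set V} (hS : ∀ p q, (p, q) ∈ H → (p ∈ S ↔ q ∈ S)) {u v : V}
    (h : Conn H u v) : u ∈ S ↔ v ∈ S := by
  induction h with
  | rel _ _ h => exact hS _ _ h
  | refl _ => exact Iff.rfl
  | symm _ _ _ ih => exact ih.symm
  | trans _ _ _ _ _ ih ih' => exact ih.trans ih'

lemma not_mem_of_not_conn {u v : V} (h : ¬ Conn H u v) : (u, v) ∉ H := fun h' => h (conn_of_mem h')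

lemma ne_of_not_conn {u v : V} (h : ¬ Conn H u v) : u ≠ v := by
  rintro rfl
  exact h (Conn.refl _)

variable [DecidableEq V]

/-- The boundary of an arc: its tail minus its head, as an integer-valued function on vertices. -/
def bd (e : V × V) : V → ℤ := Pi.single e.1 1 - Pi.single e.2 1

/-- A set of arcs is balanced if every vertex has as many outgoing as incoming arcs in it. -/
def Balanced (H : Finset (V × V)) : Prop := ∑ e ∈ H, bd e = 0

lemma Balanced.card_cut (hH : Balanced H) (S : Finset V) :
    #{e ∈ H | e.1 ∈ S ∧ e.2 ∉ S} = #{e ∈ H | e.1 ∉ S ∧ e.2 ∈ S} := by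
  have h : ∑ v ∈ S, (∑ e ∈ H, bd e) v = 0 := by rw [hH]; simp
  simp only [Finset.sum_apply] at h
  rw [Finset.sum_comm] at h
  have h1 : ∀ e : V × V, ∑ v ∈ S, bd e v =
      (if e.1 ∈ S ∧ e.2 ∉ S then 1 else 0) - (if e.1 ∉ S ∧ e.2 ∈ S then 1 else 0) := by
    intro e
    simp only [bd, Pi.sub_apply, Pi.single_apply, Finset.sum_sub_distrib, Finset.sum_ite_eq']
    by_cases h1 : e.1 ∈ S <;> by_cases h2 : e.2 ∈ S <;> simp [h1, h2]
  simp only [h1, Finset.sum_sub_distrib, Finset.sum_boole] at h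
  exact_mod_cast sub_eq_zero.mp h

section

variable [Fintype V]

/-- A vertex set that no arc of a balanced set enters is not left by any of its arcs either. -/
lemma Balanced.no_leave (hH : Balanced H) {S : Set V}
    (h : ∀ p q, (p, q) ∈ H → q ∈ S → p ∈ S) {p q : V} (hpq : (p, q) ∈ H) (hp : p ∈ S) :
    q ∈ S := by
  classical
  have hc := hH.card_cut (univ.filter (· ∈ S))
  simp only [mem_filter, mem_univ, true_and] at hc
  have h0 : #{e ∈ H | e.1 ∉ S ∧ e.2 ∈ S} = 0 := by
    rw [card_eq_zero, filter_eq_empty_iff]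
    rintro ⟨a, b⟩ he ⟨h1, h2⟩
    exact h1 (h a b he h2)
  rw [h0, card_eq_zero, filter_eq_empty_iff] at hc
  by_contra hq
  exact hc hpq ⟨hp, hq⟩

lemma Balanced.no_enter (hH : Balanced H) {S : Set V}
    (h : ∀ p q, (p, q) ∈ H → p ∈ S → q ∈ S) {p q : V} (hpq : (p, q) ∈ H) (hq : q ∈ S) :
    p ∈ S := by
  by_contra hp
  exact hH.no_leave (S := Sᶜ) (fun a b hab hb ha => hb (h a b hab ha)) hpq hp hq

/-- In a balanced arc set, a vertex set that splits a component is left by an arc inside that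
component: components are strongly connected. -/
lemma Balanced.exists_leave (hH : Balanced H) {S : Set V} {u v : V} (huv : Conn H u v)
    (hu : u ∈ S) (hv : v ∉ S) : ∃ p q, (p, q) ∈ H ∧ p ∈ S ∧ q ∉ S ∧ Conn H u p := by
  by_contra! hcon
  have h1 : ∀ p q, (p, q) ∈ H → p ∈ S ∩ {t | Conn H u t} → q ∈ S ∩ {t | Conn H u t} := by
    rintro p q hpq ⟨hp, hup⟩
    refine ⟨?_, Conn.trans hup (conn_of_mem hpq)⟩
    by_contra hq
    exact hcon p q hpq hp hq hup
  have h2 := Conn.mem_iff (S := S ∩ {t | Conn H u t})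
    (fun p q hpq => ⟨h1 p q hpq, hH.no_enter h1 hpq⟩) huv
  exact hv (h2.1 ⟨hu, Conn.refl u⟩).1

/-- Removing an arc from a balanced set, and possibly arcs of other components, leaves the ends
of the arc connected. -/
lemma Balanced.conn_of_removed (hH : Balanced H) {R H' : Finset (V × V)} (hR : H \ R ⊆ H')
    {u v : V} (huv : (u, v) ∈ H) (h : ∀ e ∈ R, e = (u, v) ∨ ¬ Conn H u e.1) :
    Conn H' u v := by
  have key := hH.no_leave (S := {t | Conn H' u t ∧ Conn H u t}) ?_ huv
    ⟨Conn.refl _, Conn.refl _⟩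
  · exact key.1
  · rintro p q hpq ⟨h1, h2⟩
    have h3 : Conn H u p := h2.trans (conn_of_mem hpq).symm
    by_cases hr : (p, q) ∈ R
    · rcases h _ hr with h4 | h4
      · obtain ⟨rfl, rfl⟩ := Prod.mk.inj h4
        exact ⟨Conn.refl _, Conn.refl _⟩
      · exact absurd h3 h4
    · exact ⟨h1.trans (conn_of_mem (hR (mem_sdiff.2 ⟨hpq, hr⟩))).symm, h3⟩

end

/-! ### Eulerian factors that cannot be merged further -/

/-- A balanced subset of the arc set `A` without isolated vertices. The latter is stated in terms
of `Conn`, so that it is inherited by arc sets with a larger connectivity relation. -/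
structure IsFactor (A H : Finset (V × V)) : Prop where
  subset : H ⊆ A
  balanced : Balanced H
  cover : ∀ v, ∃ w, w ≠ v ∧ Conn H v w

/-- A factor whose connectivity relation is maximal among the factors in `A`. -/
structure IsMaxFactor (A H : Finset (V × V)) : Prop extends IsFactor A H where
  maximal : ∀ H', IsFactor A H' → (∀ u v, (u, v) ∈ H → Conn H' u v) →
    ∀ u v, (u, v) ∈ H' → Conn H u v

/-- Exchanging arcs `R` of a maximal factor for unused arcs `B` with the same boundary cannot
join different components if the ends of the removed arcs stay connected. -/
lemma IsMaxFactor.exchange (h : IsMaxFactor A H) {R B : Finset (V × V)} (hR : R ⊆ H)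
    (hB : B ⊆ A) (hBH : Disjoint B H) (hbd : ∑ e ∈ B, bd e = ∑ e ∈ R, bd e)
    (hconn : ∀ e ∈ R, Conn (H \ R ∪ B) e.1 e.2) : ∀ e ∈ B, Conn H e.1 e.2 := by
  have hsub : ∀ u v, (u, v) ∈ H → Conn (H \ R ∪ B) u v := by
    intro u v huv
    by_cases hr : (u, v) ∈ R
    · exact hconn _ hr
    · exact conn_of_mem (mem_union_left _ (mem_sdiff.2 ⟨huv, hr⟩))
  have hf : IsFactor A (H \ R ∪ B) := by
    refine ⟨union_subset (sdiff_subset.trans h.subset) hB, ?_, fun v => ?_⟩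
    · have hd : Disjoint (H \ R) B := (hBH.mono_right sdiff_subset).symm
      have h1 := Finset.sum_sdiff (f := bd) hR
      have h2 : ∑ e ∈ H, bd e = 0 := h.balanced
      rw [Balanced, sum_union hd, hbd, h1, h2]
    · obtain ⟨w, hw, hc⟩ := h.cover v
      exact ⟨w, hw, hc.mono_of hsub⟩
  intro e he
  exact h.maximal _ hf hsub _ _ (mem_union_right _ he)

lemma IsFactor.exists_isMaxFactor [Fintype V] (h : IsFactor A H) : ∃ H, IsMaxFactor A H := by
  classical
  let c : Finset (V × V) → Finset (V × V) := fun H => univ.filter fun p => Conn H p.1 p.2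
  obtain ⟨M, hM, hmax⟩ := Finset.exists_max_image (univ.filter fun H => IsFactor A H)
    (fun H => #(c H)) ⟨H, by simpa using h⟩
  simp only [mem_filter, mem_univ, true_and] at hM hmax
  refine ⟨M, hM, fun H' hH' hsub u v huv => ?_⟩
  have hle : c M ⊆ c H' := by
    intro p hp
    simp only [c, mem_filter, mem_univ, true_and] at hp ⊢
    exact hp.mono_of hsub
  have heq := Finset.eq_of_subset_of_card_le hle (hmax H' hH')
  have : (u, v) ∈ c H' := by simpa [c] using conn_of_mem huv
  rw [← heq] at this
  simpa [c] using this

namespace IsMaxFactor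

lemma exists_out [Fintype V] (h : IsMaxFactor A H) (v : V) : ∃ w, w ≠ v ∧ (v, w) ∈ H := by
  obtain ⟨w, hw, hc⟩ := h.cover v
  obtain ⟨p, q, hpq, hp, hq, -⟩ := h.balanced.exists_leave (S := {v}) hc rfl hw
  obtain rfl : p = v := hp
  exact ⟨q, hq, hpq⟩

lemma exists_in [Fintype V] (h : IsMaxFactor A H) (v : V) : ∃ w, w ≠ v ∧ (w, v) ∈ H := by
  obtain ⟨w, hw, hc⟩ := h.cover v
  obtain ⟨p, q, hpq, hp, hq, -⟩ := h.balanced.exists_leave (S := {v}ᶜ) hc.symm hw (by simp)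
  obtain rfl : q = v := by simpa using hq
  exact ⟨p, hp, hpq⟩

/-- No 2-cycle of `A` joins two components. -/
lemma no_two_cycle (h : IsMaxFactor A H) {u v : V} (hc : ¬ Conn H u v) (huv : (u, v) ∈ A) :
    (v, u) ∉ A := by
  intro hvu
  have hc' : ¬ Conn H v u := fun h' => hc h'.symm
  refine hc (h.exchange (R := ∅) (B := {(u, v), (v, u)}) (by simp) ?_ ?_ ?_ (by simp) (u, v)
    (by simp))
  · simp [insert_subset_iff, *]
  · simp [not_mem_of_not_conn, *]
  · rw [sum_pair (by simp [ne_of_not_conn hc])]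
    simp [bd]

/-- No triangle of unused arcs of `A` meets two components. -/
lemma no_three_cycle (h : IsMaxFactor A H) {u v w : V} (hc : ¬ Conn H u v) (huv : (u, v) ∈ A)
    (hvw : (v, w) ∈ A) (hwu : (w, u) ∈ A) (hvw' : (v, w) ∉ H) (hwu' : (w, u) ∉ H)
    (h1 : v ≠ w) (h2 : w ≠ u) : False := by
  have h3 := ne_of_not_conn hc
  refine hc (h.exchange (R := ∅) (B := {(u, v), (v, w), (w, u)}) (by simp) ?_ ?_ ?_ (by simp)
    (u, v) (by simp))
  · simp [insert_subset_iff, *]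
  · simp [not_mem_of_not_conn, *]
  · rw [sum_insert (by simp [h3, h2.symm]), sum_pair (by simp [h1])]
    simp [bd]

/-- No 4-cycle of unused arcs of `A` meets two components. -/
lemma no_four_cycle (h : IsMaxFactor A H) {u v w t : V} (hc : ¬ Conn H u v) (huv : (u, v) ∈ A)
    (hvw : (v, w) ∈ A) (hwt : (w, t) ∈ A) (htu : (t, u) ∈ A) (hvw' : (v, w) ∉ H)
    (hwt' : (w, t) ∉ H) (htu' : (t, u) ∉ H) (h1 : v ≠ t) (h2 : u ≠ w) : False := by
  have h3 := ne_of_not_conn hc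
  have h4 : v ≠ w ∨ w ≠ t := by
    by_contra! h'
    exact h1 (h'.1.trans h'.2)
  refine hc (h.exchange (R := ∅) (B := {(u, v), (v, w), (w, t), (t, u)}) (by simp) ?_ ?_ ?_
    (by simp) (u, v) (by simp))
  · simp [insert_subset_iff, *]
  · simp [not_mem_of_not_conn, *]
  · rw [sum_insert (by simp [h3, h2]; grind), sum_insert (by simp; grind),
      sum_pair (by simp; grind)]
    simp [bd]

/-- No vertex of another component can be inserted into an arc of `H`. -/
lemma no_insert (h : IsMaxFactor A H) {u u' v : V} (hc : ¬ Conn H u v) (hu : (u, u') ∈ H)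
    (huv : (u, v) ∈ A) : (v, u') ∉ A := by
  intro hvu
  have hc' : ¬ Conn H v u' := fun h' => hc ((conn_of_mem hu).trans h'.symm)
  refine hc (h.exchange (R := {(u, u')}) (B := {(u, v), (v, u')}) (by simpa) ?_ ?_ ?_ ?_ (u, v)
    (by simp))
  · simp [insert_subset_iff, *]
  · simp [not_mem_of_not_conn, *]
  · rw [sum_pair (by simp [ne_of_not_conn hc])]
    simp [bd]
  · simp only [mem_singleton, forall_eq]
    exact Conn.trans (v := v) (conn_of_mem (by simp)) (conn_of_mem (by simp))

/-- Two arcs of different components cannot be crossed. -/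
lemma no_swap [Fintype V] (h : IsMaxFactor A H) {u u' w w' : V} (hc : ¬ Conn H u w)
    (hu : (u, u') ∈ H) (hw : (w, w') ∈ H) (huw : (u, w') ∈ A) : (w, u') ∉ A := by
  intro hwu
  have hc1 : ¬ Conn H u w' := fun h' => hc (h'.trans (conn_of_mem hw).symm)
  have hc2 : ¬ Conn H w u' := fun h' => hc ((conn_of_mem hu).trans h'.symm)
  have hne := ne_of_not_conn hc
  refine hc1 (h.exchange (R := {(u, u'), (w, w')}) (B := {(u, w'), (w, u')}) ?_ ?_ ?_ ?_ ?_
    (u, w') (by simp))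
  · simp [insert_subset_iff, *]
  · simp [insert_subset_iff, *]
  · simp [not_mem_of_not_conn, *]
  · rw [sum_pair (by simp [hne]), sum_pair (by simp [hne])]
    simp only [bd]
    abel
  · simp only [mem_insert, mem_singleton, forall_eq_or_imp, forall_eq]
    constructor
    · refine h.balanced.conn_of_removed subset_union_left hu ?_
      simp [hc]
    · refine h.balanced.conn_of_removed subset_union_left hw ?_
      simp only [mem_insert, mem_singleton, forall_eq_or_imp, forall_eq, true_or, and_true]
      exact Or.inr fun h' => hc h'.symm

/-- If a passage `a → x → b` of `H` could be rerouted through a vertex `y` of another component,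
then some vertex set contains `a` and `b` but not `x` and is crossed by no further arc of `H`. -/
lemma exists_cut_of_reroute (h : IsMaxFactor A H) {a x b y : V} (ha : (a, x) ∈ H)
    (hb : (x, b) ∈ H) (hc : ¬ Conn H a y) (hay : (a, y) ∈ A) (hyb : (y, b) ∈ A) (hax : a ≠ x) :
    ∃ S : Set V, a ∈ S ∧ b ∈ S ∧ x ∉ S ∧
      ∀ p q, (p, q) ∈ H → (p ∈ S ↔ q ∈ S) ∨ (p, q) = (a, x) ∨ (p, q) = (x, b) := by
  set H' := H \ {(a, x), (x, b)} ∪ {(a, y), (y, b)} with hH'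
  have hab : Conn H' a b := Conn.trans (v := y) (conn_of_mem (by simp [H']))
    (conn_of_mem (by simp [H']))
  refine ⟨{t | Conn H' a t}, Conn.refl _, hab, fun hx => ?_, fun p q hpq => ?_⟩
  · have hc' : ¬ Conn H y b :=
      fun h' => hc (((conn_of_mem ha).trans (conn_of_mem hb)).trans h'.symm)
    refine hc (h.exchange (R := {(a, x), (x, b)}) (B := {(a, y), (y, b)}) ?_ ?_ ?_ ?_ ?_
      (a, y) (by simp))
    · simp [insert_subset_iff, *]
    · simp [insert_subset_iff, *]
    · simp [not_mem_of_not_conn, *]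
    · rw [sum_pair (by grind [ne_of_not_conn hc]), sum_pair (by grind)]
      simp [bd]
    · simp only [mem_insert, mem_singleton, forall_eq_or_imp, forall_eq]
      exact ⟨hx, Conn.trans (Conn.symm hx) hab⟩
  · by_cases hr : (p, q) = (a, x) ∨ (p, q) = (x, b)
    · exact Or.inr hr
    · have : Conn H' p q := conn_of_mem (by
        rw [hH', mem_union, mem_sdiff]
        exact Or.inl ⟨hpq, by simpa using hr⟩)
      exact Or.inl ⟨fun h' => Conn.trans h' this, fun h' => Conn.trans h' this.symm⟩

end IsMaxFactor

end SpanningEulerian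

namespace SpanningEulerian

open Finset

variable {V : Type u} {A H : Finset (V × V)}

/-! ### Arcs between two components -/

/-- Two vertices are joined by an arc of `A` in at least one direction. -/
def Adj (A : Finset (V × V)) (u v : V) : Prop := (u, v) ∈ A ∨ (v, u) ∈ A

lemma Adj.symm {u v : V} (h : Adj A u v) : Adj A v u := Or.symm h

variable [DecidableEq V] [Fintype V]

namespace IsMaxFactor

/-- A vertex that is adjacent to all vertices of another component and dominates one of them
dominates them all. -/
lemma uniform_out (h : IsMaxFactor A H) {u w : V} (hc : ¬ Conn H u w)
    (hadj : ∀ v, Conn H u v → Adj A v w) (hwu : (w, u) ∈ A) {v : V} (hv : Conn H u v) :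
    (w, v) ∈ A := by
  by_contra hwv
  have hvw := (hadj v hv).resolve_right hwv
  obtain ⟨p, q, hpq, hp, hq, hvp⟩ := h.balanced.exists_leave (S := {t | (t, w) ∈ A}) hv.symm
    hvw (fun h' => h.no_two_cycle hc h' hwu)
  have hup := hv.trans hvp
  exact h.no_insert (fun h' => hc (hup.trans h')) hpq hp
    ((hadj q (hup.trans (conn_of_mem hpq))).resolve_left hq)

lemma uniform_in (h : IsMaxFactor A H) {u w : V} (hc : ¬ Conn H u w)
    (hadj : ∀ v, Conn H u v → Adj A v w) (huw : (u, w) ∈ A) {v : V} (hv : Conn H u v) :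
    (v, w) ∈ A := by
  by_contra hvw
  have hwv := (hadj v hv).resolve_left hvw
  exact h.no_two_cycle hc huw (h.uniform_out (fun h' => hc (hv.trans h'))
    (fun t ht => hadj t (hv.trans ht)) hwv hv.symm)

/-- If each of two components has a vertex adjacent to all of the other, and at most two pairs
between them are nonadjacent, then all arcs between them have the same direction. -/
lemma no_back_of_good (h : IsMaxFactor A H) {g g' x y x' y' : V} (hc : ¬ Conn H g g')
    (hcell : ∀ u v, Conn H g u → Conn H g' v → Adj A u v ∨ (u = x ∧ v = y) ∨ (u = x' ∧ v = y'))
    (hg : ∀ v, Conn H g' v → Adj A g v) (hg' : ∀ u, Conn H g u → Adj A u g')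
    (hgg : (g, g') ∈ A) {u v : V} (hu : Conn H g u) (hv : Conn H g' v) : (v, u) ∉ A := by
  intro hvu
  have hcc : ∀ {s t}, Conn H g s → Conn H g' t → ¬ Conn H s t := fun hs ht h' =>
    hc ((hs.trans h').trans ht.symm)
  have hgv : ∀ t, Conn H g' t → (g, t) ∈ A := fun t ht =>
    h.uniform_out (fun h' => hc h'.symm) (fun s hs => (hg s hs).symm) hgg ht
  have hug : ∀ t, Conn H g t → (t, g') ∈ A := fun t ht => h.uniform_in hc hg' hgg ht
  -- a vertex adjacent to the whole other component respects the direction of `g → g'`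
  have hgood' : ∀ t, Conn H g' t → (∀ s, Conn H g s → Adj A s t) →
      ∀ s, Conn H g s → (s, t) ∈ A := fun t ht hs s hgs =>
    h.uniform_in (hcc (Conn.refl _) ht) hs (hgv t ht) hgs
  have hgood : ∀ s, Conn H g s → (∀ t, Conn H g' t → Adj A s t) →
      ∀ t, Conn H g' t → (s, t) ∈ A := fun s hs ht t hgt =>
    h.uniform_out (fun h' => hcc hs (Conn.refl _) h'.symm) (fun t ht' => (ht t ht').symm)
      (hug s hs) hgt
  obtain ⟨y₂, hy₂, huy⟩ : ∃ t, Conn H g' t ∧ ¬ Adj A u t := by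
    by_contra! hcon
    exact h.no_two_cycle (hcc hu hv) (hgood u hu hcon v hv) hvu
  obtain ⟨x₂, hx₂, hxv⟩ : ∃ s, Conn H g s ∧ ¬ Adj A s v := by
    by_contra! hcon
    exact h.no_two_cycle (hcc hu hv) (hgood' v hv hcon u hu) hvu
  have hvy : y₂ ≠ v := by
    rintro rfl
    exact huy (Or.inr hvu)
  have hux : x₂ ≠ u := by
    rintro rfl
    exact hxv (Or.inr hvu)
  have hmiss : ∀ s t, Conn H g s → Conn H g' t →
      Adj A s t ∨ (s = u ∧ t = y₂) ∨ (s = x₂ ∧ t = v) := by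
    intro s t hs ht
    have h1 := hcell s t hs ht
    have h2 := (hcell u y₂ hu hy₂).resolve_left huy
    have h3 := (hcell x₂ v hx₂ hv).resolve_left hxv
    clear hcell hcc hgv hug hgood hgood' hg hg'
    grind
  have hrow : ∀ p, Conn H g p → p ≠ u → p ≠ x₂ → ∀ t, Conn H g' t → (p, t) ∈ A := by
    intro p hp h1 h2
    refine hgood p hp fun t ht => ?_
    exact (hmiss p t hp ht).resolve_right (by simp [h1, h2])
  have hcol : ∀ q, Conn H g' q → q ≠ v → q ≠ y₂ → ∀ s, Conn H g s → (s, q) ∈ A := by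
    intro q hq h1 h2
    refine hgood' q hq fun s hs => ?_
    exact (hmiss s q hs hq).resolve_right (by simp [h1, h2])
  have hin : ∀ p, (p, u) ∈ H → p ≠ u → p = x₂ := by
    intro p hp h1
    by_contra h2
    have hgp := hu.trans (conn_of_mem hp).symm
    exact h.no_insert (hcc hgp hv) hp (hrow p hgp h1 h2 v hv) hvu
  have hout : ∀ q, (v, q) ∈ H → q ≠ v → q = y₂ := by
    intro q hq h1
    by_contra h2
    have hgq := hv.trans (conn_of_mem hq)
    exact h.no_insert (fun h' => hcc hu hv h'.symm) hq hvu (hcol q hgq h1 h2 u hu)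
  have hxu : (x₂, u) ∈ H := by
    obtain ⟨p, h1, h2⟩ := h.exists_in u
    rwa [← hin p h2 h1]
  have hvy' : (v, y₂) ∈ H := by
    obtain ⟨q, h1, h2⟩ := h.exists_out v
    rwa [← hout q h2 h1]
  have hadj : Adj A x₂ y₂ := (hmiss x₂ y₂ hx₂ hy₂).resolve_right (by simp [hux, hvy])
  rcases hadj with h1 | h1
  · exact h.no_swap (hcc hx₂ hv) hxu hvy' h1 hvu
  · -- now `{u, x₂}` cannot be entered by `H`, although `g` is outside
    have hgu : g ≠ u := by
      rintro rfl
      exact huy (hg y₂ hy₂)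
    have hgx : g ≠ x₂ := by
      rintro rfl
      exact hxv (hg v hv)
    obtain ⟨p, q, hpq, hp, hq, hgp⟩ := h.balanced.exists_leave (S := {u, x₂}ᶜ) hu
      (by simp [hgu, hgx]) (by simp)
    simp only [Set.mem_compl_iff, Set.mem_insert_iff, Set.mem_singleton_iff, not_or,
      not_and, not_not] at hp hq
    by_cases hqu : q = u
    · subst hqu
      exact hp.2 (hin p hpq hp.1)
    · obtain rfl := hq hqu
      exact h.no_insert (hcc hgp hy₂) hpq (hrow p hgp hp.1 hp.2 y₂ hy₂) h1

/-- If `x`, `x'` form a 2-cycle of `H` such that every vertex of another component is adjacent to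
one of them, then the arcs between `{x, x'}` and that component have the same direction. -/
lemma oriented_of_pair (h : IsMaxFactor A H) {x x' v : V} (hc : ¬ Conn H x v)
    (hxx : (x, x') ∈ H) (hxx' : (x', x) ∈ H)
    (hadj : ∀ t, Conn H v t → Adj A x t ∨ Adj A x' t) :
    (∀ t, Conn H v t → (t, x) ∉ A ∧ (t, x') ∉ A) ∨
      (∀ t, Conn H v t → (x, t) ∉ A ∧ (x', t) ∉ A) := by
  by_contra! hcon
  obtain ⟨⟨s, hs, hs'⟩, ⟨t, ht, ht'⟩⟩ := hcon
  have hcx : ∀ {t}, Conn H v t → ¬ Conn H x t := fun ht h' => hc (h'.trans ht.symm)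
  have hcx' : ∀ {t}, Conn H v t → ¬ Conn H x' t := fun ht h' =>
    hcx ht ((conn_of_mem hxx).trans h')
  have hex : ∀ t, Conn H v t → ((t, x) ∈ A ∨ (t, x') ∈ A) → (x, t) ∉ A ∧ (x', t) ∉ A := by
    intro t ht h1
    refine ⟨fun h2 => ?_, fun h2 => ?_⟩
    · rcases h1 with h1 | h1
      · exact h.no_two_cycle (hcx ht) h2 h1
      · exact h.no_insert (hcx ht) hxx h2 h1
    · rcases h1 with h1 | h1
      · exact h.no_insert (hcx' ht) hxx' h2 h1
      · exact h.no_two_cycle (hcx' ht) h2 h1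
  obtain ⟨p, q, hpq, hp, hq, hsp⟩ := h.balanced.exists_leave
    (S := {t | (t, x) ∈ A ∨ (t, x') ∈ A}) (hs.symm.trans ht) (by grind) (by grind)
  have hvp := hs.trans hsp
  have hvq := hvp.trans (conn_of_mem hpq)
  have hq' : (x, q) ∈ A ∨ (x', q) ∈ A := by
    simp only [Set.mem_ofPred_eq, not_or] at hq
    have := hadj q hvq
    grind [Adj]
  rcases hp with hp | hp <;> rcases hq' with hq' | hq'
  · exact h.no_insert (fun h' => hcx hvp h'.symm) hpq hp hq'
  · exact h.no_swap (hcx' hvp) hxx' hpq hq' hp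
  · exact h.no_swap (hcx hvp) hxx hpq hq' hp
  · exact h.no_insert (fun h' => hcx' hvp h'.symm) hpq hp hq'

/-! ### Two missing arcs with a common end -/

/-- Two passages `aᵢ → x → b` cannot both be reroutable through `y`: the intersection of the two
cuts of `exists_cut_of_reroute` would be entered by `(x, b)`, but left by no arc of `H`. -/
lemma no_two_reroutes_in (h : IsMaxFactor A H) {a₁ a₂ x b y : V} (h1 : (a₁, x) ∈ H)
    (h2 : (a₂, x) ∈ H) (hb : (x, b) ∈ H) (hc : ¬ Conn H x y) (h1y : (a₁, y) ∈ A)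
    (h2y : (a₂, y) ∈ A) (hyb : (y, b) ∈ A) (hax₁ : a₁ ≠ x) (hax₂ : a₂ ≠ x) : a₁ = a₂ := by
  by_contra hne
  obtain ⟨S, ha, hb', hx, hS⟩ := h.exists_cut_of_reroute h1 hb
    (fun h' => hc ((conn_of_mem h1).symm.trans h')) h1y hyb hax₁
  obtain ⟨S', ha', hb'', hx', hS'⟩ := h.exists_cut_of_reroute h2 hb
    (fun h' => hc ((conn_of_mem h2).symm.trans h')) h2y hyb hax₂
  refine hx (h.balanced.no_enter (S := S ∩ S') ?_ hb ⟨hb', hb''⟩).1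
  rintro p q hpq ⟨hp, hp'⟩
  have h3 := hS p q hpq
  have h4 := hS' p q hpq
  simp only [Prod.mk.injEq] at h3 h4
  constructor <;> grind

/-- The analogue of `no_two_reroutes_in` for two passages `a → x → bᵢ`. -/
lemma no_two_reroutes_out (h : IsMaxFactor A H) {a x b₁ b₂ y : V} (ha : (a, x) ∈ H)
    (h1 : (x, b₁) ∈ H) (h2 : (x, b₂) ∈ H) (hc : ¬ Conn H x y) (hay : (a, y) ∈ A)
    (h1y : (y, b₁) ∈ A) (h2y : (y, b₂) ∈ A) (hax : a ≠ x) : b₁ = b₂ := by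
  by_contra hne
  have hc' : ¬ Conn H a y := fun h' => hc ((conn_of_mem ha).symm.trans h')
  obtain ⟨S, ha, hb', hx, hS⟩ := h.exists_cut_of_reroute ha h1 hc' hay h1y hax
  obtain ⟨S', ha', hb'', hx', hS'⟩ := h.exists_cut_of_reroute (by assumption) h2 hc' hay h2y hax
  refine hx (h.balanced.no_leave (S := S ∩ S') ?_ (by assumption) ⟨ha, ha'⟩).1
  rintro p q hpq ⟨hp, hp'⟩
  have h3 := hS p q hpq
  have h4 := hS' p q hpq
  simp only [Prod.mk.injEq] at h3 h4
  constructor <;> grind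

end IsMaxFactor

/-- In a strong digraph, every proper nonempty vertex set is left by an arc. -/
lemma exists_leave_of_strong {V : Type u} {r : V → V → Prop} {S : Set V} {s t : V}
    (hst : Relation.ReflTransGen r s t) (hs : s ∈ S) (ht : t ∉ S) :
    ∃ p q, r p q ∧ p ∈ S ∧ q ∉ S := by
  by_contra! hcon
  refine ht ?_
  clear ht
  induction hst with
  | refl => exact hs
  | tail _ h ih => exact hcon _ _ h ih

/-- The arc sets for which every maximal factor turns out to be connected: loopless and strong,
at most two pairs of vertices are nonadjacent, and a vertex set avoiding a nonadjacent pair is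
left and entered by at least two arcs. -/
structure IsNearlySemicomplete (A : Finset (V × V)) (e₁ e₂ : Sym2 V) : Prop where
  loopless : ∀ v, (v, v) ∉ A
  strong : ∀ s t : V, Relation.ReflTransGen (fun u v => (u, v) ∈ A) s t
  adj : ∀ u v, u ≠ v → Adj A u v ∨ s(u, v) = e₁ ∨ s(u, v) = e₂
  two_le : ∀ x y, x ≠ y → ¬ Adj A x y → ∀ S : Finset V, S.Nonempty → x ∉ S → y ∉ S →
    2 ≤ #{e ∈ A | e.1 ∈ S ∧ e.2 ∉ S} ∧ 2 ≤ #{e ∈ A | e.1 ∉ S ∧ e.2 ∈ S}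

/-- If `{y, z}` is a component and `x` is a vertex nonadjacent to `y` and to `z`, then `y` cannot
have both in- and out-neighbours in the component of `x`. -/
lemma IsMaxFactor.no_hub (h : IsMaxFactor A H) {e₁ e₂ : Sym2 V}
    (hA : IsNearlySemicomplete A e₁ e₂) {x y z a b : V} (hc : ¬ Conn H x y) (hyz : y ≠ z)
    (hcyz : Conn H y z) (hpair : ∀ u, Conn H y u → u = y ∨ u = z) (hxy : ¬ Adj A x y)
    (hxz : ¬ Adj A x z) (hxa : Conn H x a) (hxb : Conn H x b) (hay : (a, y) ∈ A)
    (hyb : (y, b) ∈ A) : False := by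
  have hcz : ¬ Conn H x z := fun h' => hc (h'.trans hcyz.symm)
  have hnexy := ne_of_not_conn hc
  have hnexz := ne_of_not_conn hcz
  have hadj : ∀ u v, u ≠ v → Adj A u v ∨ s(u, v) = s(x, y) ∨ s(u, v) = s(x, z) := by
    intro u v huv
    have h1 := (hA.adj x y hnexy).resolve_left hxy
    have h2 := (hA.adj x z hnexz).resolve_left hxz
    have h3 : s(x, y) ≠ s(x, z) := by simpa using ⟨hyz, fun h' => absurd h' hnexz⟩
    have h4 := hA.adj u v huv
    grind
  have hadj' : ∀ u v, u ≠ v → u ≠ x → v ≠ x → Adj A u v := by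
    intro u v huv hu hv
    have := hadj u v huv
    simp only [Sym2.eq_iff] at this
    grind
  -- the two components contain all vertices
  have hout : ∀ w, ¬ Conn H x w → ¬ Conn H y w → ∀ v, v ≠ w → Adj A v w := by
    intro w hxw hyw v hv
    have h1 := ne_of_not_conn hxw
    have h2 := ne_of_not_conn hyw
    have h3 : z ≠ w := by
      rintro rfl
      exact hyw hcyz
    have := hadj v w hv
    simp only [Sym2.eq_iff] at this
    grind
  have hdom : ∀ w, ¬ Conn H x w → ¬ Conn H y w → (w, x) ∈ A →
      ∀ u, Conn H x u ∨ Conn H y u → (w, u) ∈ A := by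
    intro w hxw hyw hwx
    have hne : ∀ {u v}, Conn H u v → ¬ Conn H u w → v ≠ w := by
      rintro u v huv huw rfl
      exact huw huv
    have h1 : ∀ u, Conn H x u → (w, u) ∈ A := fun u hu =>
      h.uniform_out hxw (fun v hv => hout w hxw hyw v (hne hv hxw)) hwx hu
    have h2 : (w, y) ∈ A := by
      by_contra h2
      have h3 := (hout w hxw hyw y (ne_of_not_conn hyw)).resolve_right h2
      have h4 : ¬ Conn H w a := fun h' => hxw (hxa.trans h'.symm)
      have h5 : ¬ Conn H a y := fun h' => hc (hxa.trans h')
      exact h.no_three_cycle hyw h3 (h1 a hxa) hay (not_mem_of_not_conn h4)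
        (not_mem_of_not_conn h5) (ne_of_not_conn h4) (ne_of_not_conn h5)
    rintro u (hu | hu)
    · exact h1 u hu
    · exact h.uniform_out hyw (fun v hv => hout w hxw hyw v (hne hv hyw)) h2 hu
  have hdom' : ∀ w, ¬ Conn H x w → ¬ Conn H y w → (x, w) ∈ A →
      ∀ u, Conn H x u ∨ Conn H y u → (u, w) ∈ A := by
    intro w hxw hyw hwx
    have hne : ∀ {u v}, Conn H u v → ¬ Conn H u w → v ≠ w := by
      rintro u v huv huw rfl
      exact huw huv
    have h1 : ∀ u, Conn H x u → (u, w) ∈ A := fun u hu =>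
      h.uniform_in hxw (fun v hv => hout w hxw hyw v (hne hv hxw)) hwx hu
    have h2 : (y, w) ∈ A := by
      by_contra h2
      have h3 := (hout w hxw hyw y (ne_of_not_conn hyw)).resolve_left h2
      have h4 : ¬ Conn H b w := fun h' => hxw (hxb.trans h')
      have h5 : ¬ Conn H y b := fun h' => hc (hxb.trans h'.symm)
      have h6 : ¬ Conn H w y := fun h' => hyw h'.symm
      exact h.no_three_cycle h5 hyb (h1 b hxb) h3 (not_mem_of_not_conn h4)
        (not_mem_of_not_conn h6) (ne_of_not_conn h4) (ne_of_not_conn h6)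
    rintro u (hu | hu)
    · exact h1 u hu
    · exact h.uniform_in hyw (fun v hv => hout w hxw hyw v (hne hv hyw)) h2 hu
  have htri : ∀ s p, ¬ Conn H x s → ¬ Conn H y s → ¬ Conn H x p → ¬ Conn H y p → (x, s) ∈ A →
      (p, x) ∈ A → (s, p) ∉ A := by
    intro s p hs hs' hp hp' hxs hpx hsp
    by_cases hcsp : Conn H s p
    · have h1 : (x, p) ∈ A := h.uniform_out (fun h' => hs h'.symm)
        (fun v hv => (hout v (fun h' => hs (h'.trans hv.symm)) (fun h' => hs' (h'.trans hv.symm)) x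
          (ne_of_not_conn fun h' => hs (h'.trans hv.symm))).symm) hxs hcsp
      exact h.no_two_cycle hp h1 hpx
    · have h6 : ¬ Conn H p x := fun h' => hp h'.symm
      exact h.no_three_cycle hs hxs hsp hpx (not_mem_of_not_conn hcsp) (not_mem_of_not_conn h6)
        (ne_of_not_conn hcsp) (ne_of_not_conn h6)
  have hall : ∀ w, Conn H x w ∨ Conn H y w := by
    by_contra! hcon
    obtain ⟨w, hw, hw'⟩ := hcon
    have hself : ∀ {u v}, Conn H x u ∨ Conn H y u → ¬ Conn H x v → ¬ Conn H y v →
        ¬ Conn H u v := by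
      rintro u v (hu | hu) hv hv' huv
      · exact hv (hu.trans huv)
      · exact hv' (hu.trans huv)
    rcases hout w hw hw' x (ne_of_not_conn hw) with h1 | h1
    · obtain ⟨q, s, hqs, ⟨hq1, hq2, hq3⟩, hs⟩ := exists_leave_of_strong
        (S := {w | ¬ Conn H x w ∧ ¬ Conn H y w ∧ (x, w) ∈ A}) (hA.strong w x) ⟨hw, hw', h1⟩
        (fun h' => h'.1 (Conn.refl _))
      by_cases hcs : Conn H x s ∨ Conn H y s
      · exact h.no_two_cycle (hself hcs hq1 hq2) (hdom' q hq1 hq2 hq3 s hcs) hqs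
      · rw [not_or] at hcs
        have h2 : (x, s) ∉ A := fun h' => hs ⟨hcs.1, hcs.2, h'⟩
        exact htri q s hq1 hq2 hcs.1 hcs.2 hq3
          ((hout s hcs.1 hcs.2 x (ne_of_not_conn hcs.1)).resolve_left h2) hqs
    · obtain ⟨s, p, hsp, hs, hp⟩ := exists_leave_of_strong
        (S := {w | ¬ Conn H x w ∧ ¬ Conn H y w ∧ (w, x) ∈ A}ᶜ) (hA.strong x w)
        (fun h' => h'.1 (Conn.refl _)) (fun h' => h' ⟨hw, hw', h1⟩)
      obtain ⟨hp1, hp2, hp3⟩ := not_not.1 hp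
      by_cases hcs : Conn H x s ∨ Conn H y s
      · exact h.no_two_cycle (hself hcs hp1 hp2) hsp (hdom p hp1 hp2 hp3 s hcs)
      · rw [not_or] at hcs
        have h2 : (s, x) ∉ A := fun h' => hs ⟨hcs.1, hcs.2, h'⟩
        exact htri s p hcs.1 hcs.2 hp1 hp2
          ((hout s hcs.1 hcs.2 x (ne_of_not_conn hcs.1)).resolve_right h2) hp3 hsp
  -- the component of `x` consists of `x`, of `P`, which dominates `{y, z}`, and of `Q`, which is
  -- dominated by `{y, z}`
  obtain ⟨P, hP⟩ : ∃ P : Finset V, ∀ u, u ∈ P ↔ Conn H x u ∧ (u, y) ∈ A := by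
    classical
    exact ⟨univ.filter fun u => Conn H x u ∧ (u, y) ∈ A, by simp⟩
  obtain ⟨Q, hQ⟩ : ∃ Q : Finset V, ∀ u, u ∈ Q ↔ Conn H x u ∧ (y, u) ∈ A := by
    classical
    exact ⟨univ.filter fun u => Conn H x u ∧ (y, u) ∈ A, by simp⟩
  have hcy : ∀ {u}, Conn H x u → ¬ Conn H u y := fun hu h' => hc (hu.trans h')
  have hcz' : ∀ {u}, Conn H x u → ¬ Conn H u z := fun hu h' => hcz (hu.trans h')
  have hxP : x ∉ P := fun h' => hxy (Or.inl ((hP x).1 h').2)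
  have hxQ : x ∉ Q := fun h' => hxy (Or.inr ((hQ x).1 h').2)
  have hyP : y ∉ P := fun h' => hc ((hP y).1 h').1
  have hyQ : y ∉ Q := fun h' => hc ((hQ y).1 h').1
  have hPQ : ∀ u, Conn H x u → u ≠ x → u ∈ P ∨ u ∈ Q := by
    intro u hu hux
    rw [hP, hQ]
    rcases hadj' u y (ne_of_not_conn (hcy hu)) hux hnexy.symm with h1 | h1
    · exact Or.inl ⟨hu, h1⟩
    · exact Or.inr ⟨hu, h1⟩
  have hadjz : ∀ u, Conn H x u → u ≠ x → ∀ v, Conn H y v → Adj A v u := by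
    intro u hu hux v hv
    rcases hpair v hv with rfl | rfl
    · exact (hadj' u v (ne_of_not_conn (hcy hu)) hux hnexy.symm).symm
    · exact (hadj' u v (ne_of_not_conn (hcz' hu)) hux hnexz.symm).symm
  have hPz : ∀ u ∈ P, (u, z) ∈ A := by
    intro u hu
    have hux : u ≠ x := fun h' => hxP (h' ▸ hu)
    rw [hP] at hu
    exact h.uniform_out (fun h' => hcy hu.1 h'.symm) (hadjz u hu.1 hux) hu.2 hcyz
  have hQz : ∀ u ∈ Q, (z, u) ∈ A := by
    intro u hu
    have hux : u ≠ x := fun h' => hxQ (h' ▸ hu)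
    rw [hQ] at hu
    exact h.uniform_in (fun h' => hcy hu.1 h'.symm) (hadjz u hu.1 hux) hu.2 hcyz
  have hnPQ : ∀ u ∈ P, ∀ v ∈ Q, (u, v) ∉ H := by
    intro u hu v hv huv
    rw [hP] at hu
    rw [hQ] at hv
    exact h.no_insert (hcy hu.1) huv hu.2 hv.2
  have hdisj : ∀ u ∈ P, u ∉ Q := by
    intro u hu hv
    rw [hP] at hu
    rw [hQ] at hv
    exact h.no_two_cycle (hcy hu.1) hu.2 hv.2
  have hQP : ∀ v ∈ Q, ∀ u ∈ P, (v, u) ∈ A → (v, u) ∈ H := by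
    intro v hv u hu hvu
    by_contra hvu'
    have hne : v ≠ u := by
      rintro rfl
      exact hdisj v hu hv
    rw [hP] at hu
    rw [hQ] at hv
    have h1 : ¬ Conn H y v := fun h' => hcy hv.1 h'.symm
    exact h.no_three_cycle (hcy hu.1) hu.2 hv.2 hvu (not_mem_of_not_conn h1) hvu'
      (ne_of_not_conn h1) hne
  have hfour : ∀ v ∈ Q, ∀ u ∈ P, (v, x) ∈ A → (x, u) ∈ A → (v, x) ∉ H → (x, u) ∈ H := by
    intro v hv u hu hvx hxu hvx'
    by_contra hxu'
    have hne : v ≠ u := by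
      rintro rfl
      exact hdisj v hu hv
    rw [hP] at hu
    rw [hQ] at hv
    have h1 : ¬ Conn H y v := fun h' => hcy hv.1 h'.symm
    exact h.no_four_cycle h1 hv.2 hvx hxu hu.2 hvx' hxu' (not_mem_of_not_conn (hcy hu.1)) hne
      hnexy.symm
  have hcases : ∀ w, w = x ∨ w ∈ P ∨ w ∈ Q ∨ w = y ∨ w = z := by
    intro w
    rcases hall w with h1 | h1
    · by_cases hw : w = x
      · exact Or.inl hw
      · have := hPQ w h1 hw
        tauto
    · have := hpair w h1
      tauto
  -- arcs entering `P` or leaving `Q`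
  have henter : ∀ p q, (p, q) ∈ A → p ∉ P → q ∈ P → p = x ∨ p ∈ Q := by
    intro p q hpq hp hq
    rcases hcases p with h1 | h1 | h1 | rfl | rfl
    · exact Or.inl h1
    · exact absurd h1 hp
    · exact Or.inr h1
    · exact absurd hpq (h.no_two_cycle (hcy ((hP q).1 hq).1) ((hP q).1 hq).2)
    · exact absurd hpq (h.no_two_cycle (hcz' ((hP q).1 hq).1) (hPz q hq))
  have hleave : ∀ p q, (p, q) ∈ A → p ∈ Q → q ∉ Q → q = x ∨ q ∈ P := by
    intro p q hpq hp hq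
    rcases hcases q with h1 | h1 | h1 | rfl | rfl
    · exact Or.inl h1
    · exact Or.inr h1
    · exact absurd h1 hq
    · exact absurd ((hQ p).1 hp).2 (h.no_two_cycle (hcy ((hQ p).1 hp).1) hpq)
    · exact absurd (hQz p hp) (h.no_two_cycle (hcz' ((hQ p).1 hp).1) hpq)
  -- arcs of `H` leaving `P` or entering `Q`
  have hleaveP : ∀ p q, (p, q) ∈ H → p ∈ P → q ∉ P → q = x := by
    intro p q hpq hp hq
    by_contra hqx
    have := hPQ q (((hP p).1 hp).1.trans (conn_of_mem hpq)) hqx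
    exact hnPQ p hp q (this.resolve_left hq) hpq
  have henterQ : ∀ p q, (p, q) ∈ H → p ∉ Q → q ∈ Q → p = x := by
    intro p q hpq hp hq
    by_contra hpx
    have := hPQ p (((hQ q).1 hq).1.trans (conn_of_mem hpq).symm) hpx
    exact hnPQ p (this.resolve_right hp) q hq hpq
  have haP : a ∈ P := (hP a).2 ⟨hxa, hay⟩
  have hbQ : b ∈ Q := (hQ b).2 ⟨hxb, hyb⟩
  -- by `hfour`, `H` contains all arcs of `A` from `x` to `P` or all those from `Q` to `x`
  by_cases hα : ∀ u ∈ P, (x, u) ∈ A → (x, u) ∈ H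
  · have h2 : 1 < #{e ∈ H | e.1 ∈ P ∧ e.2 ∉ P} := by
      rw [h.balanced.card_cut P]
      refine lt_of_lt_of_le (hA.two_le x y hnexy hxy P ⟨a, haP⟩ hxP hyP).2 (card_le_card ?_)
      rintro ⟨p, q⟩ he
      simp only [mem_filter] at he ⊢
      obtain ⟨hpq, hp, hq⟩ := he
      refine ⟨?_, hp, hq⟩
      rcases henter p q hpq hp hq with rfl | h1
      · exact hα q hq hpq
      · exact hQP p h1 q hq hpq
    obtain ⟨⟨a₁, c₁⟩, h3, ⟨a₂, c₂⟩, h4, hne⟩ := one_lt_card.1 h2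
    simp only [mem_filter] at h3 h4
    obtain rfl := hleaveP a₁ c₁ h3.1 h3.2.1 h3.2.2
    obtain rfl := hleaveP a₂ c₂ h4.1 h4.2.1 h4.2.2
    obtain ⟨p, q, hpq, hp, hq, -⟩ := h.balanced.exists_leave (S := {t | t ∉ Q}) hxb hxQ
      (not_not.2 hbQ)
    have hq : q ∈ Q := not_not.1 hq
    obtain rfl := henterQ p q hpq hp hq
    refine hne ?_
    rw [h.no_two_reroutes_in h3.1 h4.1 hpq hc ((hP a₁).1 h3.2.1).2 ((hP a₂).1 h4.2.1).2
      ((hQ q).1 hq).2 (fun h' => hxP (h' ▸ h3.2.1)) (fun h' => hxP (h' ▸ h4.2.1))]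
  · push Not at hα
    obtain ⟨u, hu, hxu, hxu'⟩ := hα
    have h2 : 1 < #{e ∈ H | e.1 ∉ Q ∧ e.2 ∈ Q} := by
      rw [← h.balanced.card_cut Q]
      refine lt_of_lt_of_le (hA.two_le x y hnexy hxy Q ⟨b, hbQ⟩ hxQ hyQ).1 (card_le_card ?_)
      rintro ⟨p, q⟩ he
      simp only [mem_filter] at he ⊢
      obtain ⟨hpq, hp, hq⟩ := he
      refine ⟨?_, hp, hq⟩
      rcases hleave p q hpq hp hq with rfl | h1
      · by_contra h'
        exact hxu' (hfour p hp u hu hpq hxu h')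
      · exact hQP p hp q h1 hpq
    obtain ⟨⟨c₁, b₁⟩, h3, ⟨c₂, b₂⟩, h4, hne⟩ := one_lt_card.1 h2
    simp only [mem_filter] at h3 h4
    obtain rfl := henterQ c₁ b₁ h3.1 h3.2.1 h3.2.2
    obtain rfl := henterQ c₂ b₂ h4.1 h4.2.1 h4.2.2
    obtain ⟨p, q, hpq, hp, hq, -⟩ := h.balanced.exists_leave (S := {t | t ∈ P}) hxa.symm haP hxP
    obtain rfl := hleaveP p q hpq hp hq
    refine hne ?_
    rw [h.no_two_reroutes_out hpq h3.1 h4.1 hc ((hP p).1 hp).2 ((hQ b₁).1 h3.2.2).2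
      ((hQ b₂).1 h4.2.2).2 (fun h' => hxP (h' ▸ hp))]

end SpanningEulerian

namespace SpanningEulerian

open Finset

variable {V : Type u} {A H : Finset (V × V)} {e₁ e₂ : Sym2 V}

/-! ### Connectedness of maximal factors -/

/-- A pair of vertices is represented at most once in the product of two components. -/
lemma exists_cell (e : Sym2 V) {u₀ v₀ : V} (hc : ¬ Conn H u₀ v₀) :
    ∃ x y, ∀ u v, Conn H u₀ u → Conn H v₀ v → s(u, v) = e → u = x ∧ v = y := by
  induction e with
  | h p q =>
    by_cases hp : Conn H u₀ p
    · refine ⟨p, q, fun u v hu hv huv => ?_⟩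
      rcases Sym2.eq_iff.1 huv with h' | ⟨-, rfl⟩
      · exact h'
      · exact absurd (hp.trans hv.symm) hc
    · refine ⟨q, p, fun u v hu hv huv => ?_⟩
      rcases Sym2.eq_iff.1 huv with ⟨rfl, -⟩ | h'
      · exact absurd hu hp
      · exact h'

namespace IsMaxFactor

variable [DecidableEq V]

/-- There are representatives of the components any two of which are adjacent. -/
lemma exists_transversal (h : IsMaxFactor A H) (hA : IsNearlySemicomplete A e₁ e₂) :
    ∃ σ : V → V, (∀ v, Conn H v (σ v)) ∧ ∀ u v, ¬ Conn H u v → Adj A (σ u) (σ v) := by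
  have havoid : ∀ p r : V, (p = r ∨ ¬ Conn H p r) → ∀ v, ∃ w, Conn H v w ∧ w ≠ p ∧ w ≠ r := by
    intro p r hpr v
    obtain ⟨w, hwv, hc⟩ := h.cover v
    by_cases hv : v ≠ p ∧ v ≠ r
    · exact ⟨v, Conn.refl v, hv⟩
    · refine ⟨w, hc, ?_⟩
      have := hc.symm
      grind
  -- one end of each nonadjacent pair is avoided, chosen so that no component is exhausted
  obtain ⟨p, r, hpr, h1, h2⟩ : ∃ p r : V, (p = r ∨ ¬ Conn H p r) ∧
      (∀ u v, ¬ Conn H u v → s(u, v) = e₁ → u = p ∨ v = p) ∧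
      (∀ u v, ¬ Conn H u v → s(u, v) = e₂ → u = r ∨ v = r ∨ u = p ∨ v = p) := by
    induction e₁ with
    | h p₁ q₁ =>
    induction e₂ with
    | h p₂ q₂ =>
    have h1 : ∀ u v, ¬ Conn H u v → s(u, v) = s(p₁, q₁) → u = p₁ ∨ v = p₁ := by
      intro u v _ huv
      rcases Sym2.eq_iff.1 huv with h' | h'
      · exact Or.inl h'.1
      · exact Or.inr h'.2
    by_cases hp : Conn H p₁ p₂
    · by_cases hq : Conn H p₁ q₂
      · refine ⟨p₁, p₁, Or.inl rfl, h1, fun u v hc huv => absurd ?_ hc⟩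
        rcases Sym2.eq_iff.1 huv with ⟨rfl, rfl⟩ | ⟨rfl, rfl⟩
        · exact hp.symm.trans hq
        · exact hq.symm.trans hp
      · refine ⟨p₁, q₂, Or.inr hq, h1, fun u v _ huv => ?_⟩
        rcases Sym2.eq_iff.1 huv with ⟨rfl, rfl⟩ | ⟨rfl, rfl⟩ <;> simp
    · refine ⟨p₁, p₂, Or.inr hp, h1, fun u v _ huv => ?_⟩
      rcases Sym2.eq_iff.1 huv with ⟨rfl, rfl⟩ | ⟨rfl, rfl⟩ <;> simp
  choose σ hσ using havoid p r hpr
  refine ⟨σ, fun v => (hσ v).1, fun u v hc => ?_⟩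
  have hc' : ¬ Conn H (σ u) (σ v) := fun h' => hc (((hσ u).1.trans h').trans (hσ v).1.symm)
  have hu := (hσ u).2
  have hv := (hσ v).2
  rcases hA.adj _ _ (ne_of_not_conn hc') with h3 | h3 | h3
  · exact h3
  · have := h1 _ _ hc' h3
    tauto
  · have := h2 _ _ hc' h3
    tauto

variable [Fintype V]

/-- If no vertex of the component of `u` is adjacent to all of another component, then all arcs
between the two have the same direction. -/
lemma oriented_of_no_good (h : IsMaxFactor A H) (hA : IsNearlySemicomplete A e₁ e₂)
    {u v x y x' y' : V} (hc : ¬ Conn H u v)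
    (hcell : ∀ s t, Conn H u s → Conn H v t → Adj A s t ∨ (s = x ∧ t = y) ∨ (s = x' ∧ t = y'))
    (hbad : ∀ s, Conn H u s → ∃ t, Conn H v t ∧ ¬ Adj A s t) :
    (∀ s t, Conn H u s → Conn H v t → (t, s) ∉ A) ∨
      (∀ s t, Conn H u s → Conn H v t → (s, t) ∉ A) := by
  obtain ⟨w, hwu, huw⟩ := h.exists_out u
  have hcw := conn_of_mem huw
  obtain ⟨y₁, hy₁, huy⟩ := hbad u (Conn.refl u)
  obtain ⟨y₂, hy₂, hwy⟩ := hbad w hcw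
  have h1 := (hcell u y₁ (Conn.refl u) hy₁).resolve_left huy
  have h2 := (hcell w y₂ hcw hy₂).resolve_left hwy
  have hmiss : ∀ s t, Conn H u s → Conn H v t → ¬ Adj A s t →
      (s = u ∧ t = y₁) ∨ (s = w ∧ t = y₂) := by
    intro s t hs ht hst
    have h3 := (hcell s t hs ht).resolve_left hst
    clear hcell hbad
    grind
  have hpair : ∀ s, Conn H u s → s = u ∨ s = w := by
    intro s hs
    obtain ⟨t, ht, hst⟩ := hbad s hs
    rcases hmiss s t hs ht hst with h3 | h3
    · exact Or.inl h3.1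
    · exact Or.inr h3.1
  have hwu' : (w, u) ∈ H := by
    obtain ⟨t, htw, hwt⟩ := h.exists_out w
    rwa [← (hpair t (hcw.trans (conn_of_mem hwt))).resolve_right htw]
  by_cases hy : y₁ = y₂
  · subst hy
    by_contra! hcon
    obtain ⟨⟨s, t, hs, ht, hts⟩, ⟨s', t', hs', ht', hst'⟩⟩ := hcon
    have hcu : ∀ {q}, Conn H v q → ¬ Conn H q u := fun hq h' => hc (h'.symm.trans hq.symm)
    have hadj : ∀ q, Conn H v q → Adj A w q → Adj A u q := by
      intro q hq hwq
      by_contra huq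
      rcases hmiss u q (Conn.refl u) hq huq with h3 | h3
      · exact hwy (h3.2 ▸ hwq)
      · exact hwu h3.1.symm
    -- arcs at `w` can be replaced by arcs at `u`
    have htu : (t, u) ∈ A := by
      rcases hpair s hs with rfl | rfl
      · exact hts
      · rcases hadj t ht (Or.inr hts) with h3 | h3
        · exact absurd hts (h.no_insert (fun h' => hcu ht h'.symm) huw h3)
        · exact h3
    have hut : (u, t') ∈ A := by
      rcases hpair s' hs' with rfl | rfl
      · exact hst'
      · rcases hadj t' ht' (Or.inl hst') with h3 | h3
        · exact h3
        · exact absurd h3 (h.no_insert (fun h' => hcu ht' (hcw.trans h').symm) hwu' hst')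
    exact h.no_hub hA (hcu hy₁) hwu.symm hcw hpair (fun h' => huy h'.symm)
      (fun h' => hwy h'.symm) (hy₁.symm.trans ht) (hy₁.symm.trans ht') htu hut
  · have hor := h.oriented_of_pair hc huw hwu' (fun t ht => by
      by_contra! hcon
      rcases hmiss u t (Conn.refl u) ht hcon.1 with h3 | h3
      · rcases hmiss w t hcw ht hcon.2 with h4 | h4
        · exact hwu h4.1
        · exact hy (h3.2.symm.trans h4.2)
      · exact hwu h3.1.symm)
    refine hor.imp (fun h3 s t hs ht => ?_) (fun h3 s t hs ht => ?_)
    · rcases hpair s hs with rfl | rfl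
      · exact (h3 t ht).1
      · exact (h3 t ht).2
    · rcases hpair s hs with rfl | rfl
      · exact (h3 t ht).1
      · exact (h3 t ht).2

/-- All arcs between two components have the same direction. -/
lemma oriented (h : IsMaxFactor A H) (hA : IsNearlySemicomplete A e₁ e₂) {u v : V}
    (hc : ¬ Conn H u v) :
    (∀ s t, Conn H u s → Conn H v t → (t, s) ∉ A) ∨
      (∀ s t, Conn H u s → Conn H v t → (s, t) ∉ A) := by
  have hc' : ¬ Conn H v u := fun h' => hc h'.symm
  obtain ⟨x, y, hxy⟩ := exists_cell e₁ hc
  obtain ⟨x', y', hxy'⟩ := exists_cell e₂ hc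
  have hcell : ∀ s t, Conn H u s → Conn H v t →
      Adj A s t ∨ (s = x ∧ t = y) ∨ (s = x' ∧ t = y') := by
    intro s t hs ht
    exact (hA.adj s t (ne_of_not_conn fun h' => hc ((hs.trans h').trans ht.symm))).imp_right
      (Or.imp (hxy s t hs ht) (hxy' s t hs ht))
  have hcell' : ∀ t s, Conn H v t → Conn H u s →
      Adj A t s ∨ (t = y ∧ s = x) ∨ (t = y' ∧ s = x') := by
    intro t s ht hs
    exact (hcell s t hs ht).imp Adj.symm (Or.imp And.symm And.symm)
  by_cases hgood : ∃ g, Conn H u g ∧ ∀ t, Conn H v t → Adj A g t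
  · by_cases hgood' : ∃ g, Conn H v g ∧ ∀ s, Conn H u s → Adj A g s
    · obtain ⟨g, hg, hgt⟩ := hgood
      obtain ⟨g', hg', hgs⟩ := hgood'
      have hcg : ¬ Conn H g g' := fun h' => hc ((hg.trans h').trans hg'.symm)
      rcases hgt g' hg' with h1 | h1
      · left
        intro s t hs ht
        exact h.no_back_of_good hcg (fun s t hs ht => hcell s t (hg.trans hs) (hg'.trans ht))
          (fun t ht => hgt t (hg'.trans ht)) (fun s hs => (hgs s (hg.trans hs)).symm) h1
          (hg.symm.trans hs) (hg'.symm.trans ht)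
      · right
        intro s t hs ht
        exact h.no_back_of_good (fun h' => hcg h'.symm)
          (fun t s ht hs => hcell' t s (hg'.trans ht) (hg.trans hs))
          (fun s hs => hgs s (hg.trans hs)) (fun t ht => (hgt t (hg'.trans ht)).symm) h1
          (hg'.symm.trans ht) (hg.symm.trans hs)
    · push Not at hgood'
      exact (h.oriented_of_no_good hA hc' hcell' hgood').symm.imp
        (fun h1 s t hs ht => h1 t s ht hs) (fun h1 s t hs ht => h1 t s ht hs)
  · push Not at hgood
    exact h.oriented_of_no_good hA hc hcell hgood

/-- A maximal factor of a nearly semicomplete digraph is connected. -/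
theorem conn (h : IsMaxFactor A H) (hA : IsNearlySemicomplete A e₁ e₂) (u v : V) :
    Conn H u v := by
  classical
  obtain ⟨σ, hσ, hadj⟩ := h.exists_transversal hA
  -- the dominance relation between components, which is a transitive tournament
  let T : V → V → Prop := fun u v => ¬ Conn H u v ∧ (σ u, σ v) ∈ A
  have hT : ∀ u v, T u v → ∀ s t, Conn H u s → Conn H v t → (t, s) ∉ A := by
    rintro u v ⟨hc, huv⟩
    exact (h.oriented hA hc).resolve_right fun h' => h' _ _ (hσ u) (hσ v) huv
  have htrans : ∀ u v w, T u v → T v w → T u w := by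
    intro u v w huv hvw
    have hc : ¬ Conn H u w := fun h' => hT u v huv _ _ (h'.trans (hσ w)) (hσ v) hvw.2
    refine ⟨hc, (hadj u w hc).resolve_right fun hwu => ?_⟩
    have hcσ : ∀ {a b}, ¬ Conn H a b → ¬ Conn H (σ a) (σ b) := fun hab h' =>
      hab (((hσ _).trans h').trans (hσ _).symm)
    have h1 := hcσ hvw.1
    have h2 : ¬ Conn H (σ w) (σ u) := fun h' => hcσ hc h'.symm
    exact h.no_three_cycle (hcσ huv.1) huv.2 hvw.2 hwu (not_mem_of_not_conn h1)
      (not_mem_of_not_conn h2) (ne_of_not_conn h1) (ne_of_not_conn h2)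
  obtain ⟨m, -, hm⟩ := Finset.exists_max_image (univ : Finset V)
    (fun w => #(univ.filter fun v => T v w)) ⟨u, mem_univ u⟩
  have hsink : ∀ w, ¬ T m w := by
    intro w hmw
    refine absurd (hm w (mem_univ w)) (not_le.2 (card_lt_card ?_))
    rw [Finset.ssubset_iff_of_subset]
    · exact ⟨m, by simpa using hmw, by simp [T, Conn.refl]⟩
    · intro v hv
      simp only [mem_filter, mem_univ, true_and] at hv ⊢
      exact htrans _ _ _ hv hmw
  have hall : ∀ t, Conn H m t := by
    by_contra! hcon
    obtain ⟨t, ht⟩ := hcon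
    obtain ⟨p, q, hpq, hp, hq⟩ := exists_leave_of_strong (S := {t | Conn H m t})
      (hA.strong m t) (Conn.refl m) ht
    have hq : ¬ Conn H m q := hq
    refine hsink q ⟨hq, (hadj m q hq).resolve_right fun h' => ?_⟩
    exact hT q m ⟨fun h'' => hq h''.symm, h'⟩ q p (Conn.refl q) hp hpq
  exact (hall u).symm.trans (hall v)

end IsMaxFactor

end SpanningEulerian

namespace SpanningEulerian

open Finset

/-! ### Existence of a factor -/

section Hall

variable {V : Type u} {A : Finset (V × V)}

/-- The relation whose perfect matchings encode factors of `A`: an arc is matched to itself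
(and is then unused) or to a successor on a trail, where each vertex also acts as a token that
has to be passed between an arc entering and an arc leaving it. -/
def Follows (A : Finset (V × V)) : (V × V) ⊕ V → (V × V) ⊕ V → Prop
  | .inl e, .inl f => e = f ∨ (e ∈ A ∧ f ∈ A ∧ e.2 = f.1)
  | .inl e, .inr v => e ∈ A ∧ e.2 = v
  | .inr v, .inl f => f ∈ A ∧ f.1 = v
  | .inr _, .inr _ => False

variable [DecidableEq V] [Fintype V]

/-- The nonfixed arcs of a matching in `Follows A` form a factor. -/
lemma isFactor_of_injective (hA : ∀ v, (v, v) ∉ A) {f : (V × V) ⊕ V → (V × V) ⊕ V}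
    (hf : Function.Injective f) (hS : ∀ i, Follows A i (f i)) :
    IsFactor A (univ.filter fun e => f (.inl e) ≠ .inl e) := by
  have hbij : Function.Bijective f := Finite.injective_iff_bijective.1 hf
  let tail : (V × V) ⊕ V → V := Sum.elim Prod.fst id
  let head : (V × V) ⊕ V → V := Sum.elim Prod.snd id
  have hsucc : ∀ i, f i ≠ i → head i = tail (f i) := by
    intro i hi
    have h1 := hS i
    rcases i with e | v <;> rcases hfi : f _ with e' | v' <;> rw [hfi] at h1 hi <;>
      simp only [Follows, head, tail, Sum.elim_inl, Sum.elim_inr, id] at h1 ⊢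
    · exact (h1.resolve_left fun h' => hi (by rw [h'])).2.2
    · exact h1.2
    · exact h1.2.symm
  have hsum : ∑ i, (if f i ≠ i then bd (tail i, head i) else (0 : V → ℤ)) = 0 := by
    have h1 : ∀ i, (if f i ≠ i then bd (tail i, head i) else (0 : V → ℤ)) =
        Pi.single (tail i) 1 - Pi.single (tail (f i)) 1 := by
      intro i
      split_ifs with hi
      · rw [hsucc i hi, bd]
      · rw [not_not.1 hi, sub_self]
    simp only [h1, sum_sub_distrib]
    rw [sub_eq_zero]
    exact (hbij.sum_comp fun i => (Pi.single (tail i) 1 : V → ℤ)).symm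
  refine ⟨fun e he => ?_, ?_, fun v => ?_⟩
  · simp only [mem_filter, mem_univ, true_and] at he
    have h1 := hS (.inl e)
    rcases hfi : f (.inl e) with e' | v' <;> rw [hfi] at h1 he <;> simp only [Follows] at h1
    · exact (h1.resolve_left fun h' => he (by rw [h'])).1
    · exact h1.1
  · rw [Fintype.sum_sum_type] at hsum
    simp only [tail, head, Sum.elim_inl, Sum.elim_inr, id, bd, sub_self, ite_self, sum_const_zero,
      add_zero] at hsum
    rw [Balanced, sum_filter]
    exact hsum
  · have h1 := hS (.inr v)
    rcases hfi : f (.inr v) with e | v' <;> rw [hfi] at h1 <;> simp only [Follows] at h1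
    obtain ⟨he, rfl⟩ := h1
    refine ⟨e.2, fun h' => hA e.1 ?_, conn_of_mem ?_⟩
    · convert he
      exact h'.symm
    · simp only [mem_filter, mem_univ, true_and, Prod.mk.eta]
      intro h'
      have := hf (hfi.trans h'.symm)
      simp at this

/-- A sufficient condition of Hoffman type for the existence of a factor. -/
theorem exists_isFactor (hA : ∀ v, (v, v) ∉ A)
    (hcut : ∀ R Y : Finset V, Disjoint R Y → #Y ≤ #{e ∈ A | e.1 ∈ R ∪ Y ∧ e.2 ∉ R}) :
    ∃ H, IsFactor A H := by
  classical
  obtain ⟨f, hf, hS⟩ := (Fintype.all_card_le_filter_rel_iff_exists_injective (Follows A)).1 (by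
    intro X
    set B := X.toLeft with hB
    set Z := X.toRight with hZ
    set R := (B ∩ A).image Prod.snd with hR
    have h1 := hcut R (Z \ R) disjoint_sdiff
    set C := A.filter (fun e => e.1 ∈ R ∪ Z \ R ∧ e.2 ∉ R) with hC
    have hBC : Disjoint B C := by
      rw [Finset.disjoint_left]
      intro e he he'
      simp only [hC, mem_filter] at he'
      exact he'.2.2 (mem_image.2 ⟨e, mem_inter.2 ⟨he, he'.1⟩, rfl⟩)
    have h2 : (B ∪ C).disjSum R ⊆ univ.filter fun b => ∃ a ∈ X, Follows A a b := by
      intro b hb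
      simp only [mem_filter, mem_univ, true_and]
      rcases b with e | v
      · rcases mem_union.1 (inl_mem_disjSum.1 hb) with he | he
        · exact ⟨.inl e, mem_toLeft.1 he, Or.inl rfl⟩
        · simp only [hC, mem_filter, union_sdiff_self_eq_union, mem_union] at he
          obtain ⟨heA, he | he, -⟩ := he
          · obtain ⟨d, hd, hde⟩ := mem_image.1 he
            exact ⟨.inl d, mem_toLeft.1 (mem_inter.1 hd).1,
              Or.inr ⟨(mem_inter.1 hd).2, heA, hde⟩⟩
          · exact ⟨.inr e.1, mem_toRight.1 he, heA, rfl⟩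
      · obtain ⟨d, hd, hde⟩ := mem_image.1 (inr_mem_disjSum.1 hb)
        exact ⟨.inl d, mem_toLeft.1 (mem_inter.1 hd).1, (mem_inter.1 hd).2, hde⟩
    have h3 := card_le_card h2
    rw [card_disjSum, card_union_of_disjoint hBC] at h3
    have h4 : #X = #B + #Z := card_toLeft_add_card_toRight.symm
    have h5 : #Z ≤ #(Z \ R) + #R := card_le_card_sdiff_add_card
    omega)
  exact ⟨_, isFactor_of_injective hA hf hS⟩

end Hall

/-! ### Spanning eulerian subdigraphs of semicomplete digraphs -/

section Digraph

variable {V : Type u} {D : Digraph V}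

/-- A balanced connected arc set without loops is the arc set of an eulerian digraph. -/
lemma isEulerian_of_conn [Fintype V] [DecidableEq V] [Nonempty V] {H : Finset (V × V)}
    (hl : ∀ v, (v, v) ∉ H) (hH : Balanced H) (hc : ∀ u v, Conn H u v) :
    ({ Adj := fun u v => (u, v) ∈ H } : Digraph V).IsEulerian := by
  constructor
  · have : ∀ u v, Conn H u v →
        ({ Adj := fun u v => (u, v) ∈ H } : Digraph V).toSimpleGraphInclusive.Reachable u v := by
      intro u v h
      induction h with
      | rel u v h =>
        refine SimpleGraph.Adj.reachable ?_
        refine (SimpleGraph.fromRel_adj _ _ _).2 ⟨?_, Or.inl h⟩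
        rintro rfl
        exact hl u h
      | refl u => exact SimpleGraph.Reachable.refl u
      | symm _ _ _ ih => exact ih.symm
      | trans _ _ _ _ _ ih ih' => exact ih.trans ih'
    exact { preconnected := fun u v => this u v (hc u v), nonempty := inferInstance }
  · intro v
    have h1 : {w | (v, w) ∈ H} = ((H.filter fun e => e.1 ∈ ({v} : Finset V) ∧
        e.2 ∉ ({v} : Finset V)).image Prod.snd : Set V) := by
      ext w
      simp only [coe_image, coe_filter, mem_singleton]
      constructor
      · intro h
        exact ⟨(v, w), ⟨h, rfl, fun h' : w = v => hl v (h' ▸ h)⟩, rfl⟩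
      · rintro ⟨⟨a, b⟩, ⟨h, rfl, -⟩, rfl⟩
        exact h
    have h2 : {w | (w, v) ∈ H} = ((H.filter fun e => e.1 ∉ ({v} : Finset V) ∧
        e.2 ∈ ({v} : Finset V)).image Prod.fst : Set V) := by
      ext w
      simp only [coe_image, coe_filter, mem_singleton]
      constructor
      · intro h
        exact ⟨(w, v), ⟨h, fun h' : w = v => hl v (h' ▸ h), rfl⟩, rfl⟩
      · rintro ⟨⟨a, b⟩, ⟨h, -, rfl⟩, rfl⟩
        exact h
    rw [Digraph.inDeg, Digraph.outDeg, h1, h2, Set.ncard_coe_finset, Set.ncard_coe_finset,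
      card_image_of_injOn, card_image_of_injOn, hH.card_cut]
    · rintro ⟨a, b⟩ h ⟨a', b'⟩ h' hab
      simp only [coe_filter, mem_singleton, Set.mem_ofPred_eq] at h h' hab
      rw [h.2.1, h'.2.1, hab]
    · rintro ⟨a, b⟩ h ⟨a', b'⟩ h' hab
      simp only [coe_filter, mem_singleton, Set.mem_ofPred_eq] at h h' hab
      rw [h.2.2, h'.2.2, hab]

/-- Every cut of a `k`-arc-strong digraph with arc set `E` contains at least `k` arcs. -/
lemma le_card_cut [Fintype V] [DecidableEq V] {k : ℕ} (hD : D.IsArcStrong k)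
    {E : Finset (V × V)} (hE : ∀ e, e ∈ E ↔ D.Adj e.1 e.2) {S : Finset V} (hS : S.Nonempty)
    {t : V} (ht : t ∉ S) : k ≤ #{e ∈ E | e.1 ∈ S ∧ e.2 ∉ S} := by
  by_contra! hlt
  obtain ⟨s, hs⟩ := hS
  obtain ⟨p, q, hpq, hp, hq⟩ := exists_leave_of_strong (S := (S : Set V))
    (hD _ (fun e he => (hE e).1 (mem_filter.1 (mem_coe.1 he)).1) hlt s t) hs ht
  exact hpq.2 (mem_coe.2 (mem_filter.2 ⟨(hE _).2 hpq.1, hp, hq⟩))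

/-- Deleting `k` arcs from a `(k + 1)`-arc-strong semicomplete digraph leaves a digraph with
enough arcs across every cut for a factor to exist. -/
lemma card_le_card_cut [Fintype V] [DecidableEq V] (hD : D.IsSemicomplete) {k : ℕ}
    (hk : D.IsArcStrong (k + 1)) {F E A : Finset (V × V)} (hF : #F = k)
    (hE : ∀ e, e ∈ E ↔ D.Adj e.1 e.2) (hA : A = E \ F)
    (hs : ∀ s t : V, Relation.ReflTransGen (fun u v => (u, v) ∈ A) s t)
    (hV : ∀ v : V, ∃ w, w ≠ v) (R Y : Finset V) (hRY : Disjoint R Y) :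
    #Y ≤ #{e ∈ A | e.1 ∈ R ∪ Y ∧ e.2 ∉ R} := by
  induction hn : #Y generalizing R Y with
  | zero => exact Nat.zero_le _
  | succ n ih =>
  have hdj := Finset.disjoint_left.1 hRY
  by_cases h1 : ∃ p q, (p, q) ∈ A ∧ p ∈ R ∪ Y ∧ q ∈ Y
  · -- such a `q` can be moved to `R`
    obtain ⟨p, q, hpq, hp, hq⟩ := h1
    refine lt_of_le_of_lt (ih (insert q R) (Y.erase q) ?_ ?_) (card_lt_card ?_)
    · rw [Finset.disjoint_left]
      intro t ht ht'
      rcases mem_insert.1 ht with rfl | h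
      · exact (mem_erase.1 ht').1 rfl
      · exact hdj h (mem_erase.1 ht').2
    · rw [card_erase_of_mem hq, hn, Nat.add_sub_cancel]
    · rw [Finset.ssubset_iff_of_subset]
      · refine ⟨(p, q), mem_filter.2 ⟨hpq, hp, fun h => hdj h hq⟩, ?_⟩
        simp
      · rintro ⟨s, t⟩ h
        simp only [mem_filter, mem_union, mem_insert, mem_erase, not_or] at h ⊢
        refine ⟨h.1, ?_, h.2.2.2⟩
        rcases h.2.1 with (rfl | h') | h'
        · exact Or.inr hq
        · exact Or.inl h'
        · exact Or.inr h'.2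
  by_cases h2 : ∃ p q, (p, q) ∈ A ∧ p ∈ Y ∧ q ∉ R ∪ Y
  · -- such a `p` can be dropped from `Y`
    obtain ⟨p, q, hpq, hp, hq⟩ := h2
    rw [mem_union, not_or] at hq
    refine lt_of_le_of_lt (ih R (Y.erase p) ?_ ?_) (card_lt_card ?_)
    · exact hRY.mono_right (erase_subset _ _)
    · rw [card_erase_of_mem hp, hn, Nat.add_sub_cancel]
    · rw [Finset.ssubset_iff_of_subset]
      · refine ⟨(p, q), mem_filter.2 ⟨hpq, mem_union_right _ hp, hq.1⟩, ?_⟩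
        have hpR : p ∉ R := fun h => hdj h hp
        simp [hpR]
      · rintro ⟨s, t⟩ h
        simp only [mem_filter, mem_union, mem_erase] at h ⊢
        exact ⟨h.1, h.2.1.imp_right And.right, h.2.2⟩
  push Not at h1 h2
  obtain ⟨y, hy⟩ : Y.Nonempty := card_pos.1 (by omega)
  have hyR : y ∉ R := fun h => hdj h hy
  rcases R.eq_empty_or_nonempty with rfl | hR
  · obtain ⟨w, hw⟩ := hV y
    obtain ⟨p, q, hpq, hp, -⟩ := exists_leave_of_strong (S := {y}) (hs y w) rfl hw
    obtain rfl : p = y := hp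
    have hq : q ∉ Y := h1 p q hpq (mem_union_right _ hy)
    exact absurd (h2 p q hpq hy) (by simpa using hq)
  · -- `Y` is independent, so at least `#Y - 1` arcs of `F` lie inside `Y`
    have hin : ∀ t ∈ Y.erase y, (y, t) ∈ F ∨ (t, y) ∈ F := by
      intro t ht
      obtain ⟨hty, ht⟩ := mem_erase.1 ht
      have h3 := h1 y t
      have h4 := h1 t y
      simp only [hA, mem_sdiff, hE] at h3 h4
      rcases hD.adjacent y t hty.symm with h | h
      · by_contra! h'
        exact h3 ⟨h, h'.1⟩ (mem_union_right _ hy) ht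
      · by_contra! h'
        exact h4 ⟨h, h'.2⟩ (mem_union_right _ ht) hy
    set g : V → V × V := fun t => if (y, t) ∈ F then (y, t) else (t, y) with hg
    set G := (Y.erase y).image g with hG
    have hGF : G ⊆ F := by
      intro e he
      obtain ⟨t, ht, rfl⟩ := mem_image.1 he
      simp only [hg]
      split_ifs with h
      · exact h
      · exact (hin t ht).resolve_left h
    have hGY : ∀ e ∈ G, e.1 ∈ Y := by
      intro e he
      obtain ⟨t, ht, rfl⟩ := mem_image.1 he
      simp only [hg]
      split_ifs with h
      · exact hy
      · exact (mem_erase.1 ht).2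
    have hGc : #G = n := by
      rw [hG, card_image_of_injOn, card_erase_of_mem hy, hn, Nat.add_sub_cancel]
      intro s hs t ht hst
      have h3 := (mem_erase.1 (mem_coe.1 hs)).1
      have h4 := (mem_erase.1 (mem_coe.1 ht)).1
      simp only [hg] at hst
      split_ifs at hst <;> simp only [Prod.mk.injEq] at hst <;> grind
    have h3 := le_card_cut hk hE hR hyR
    have h4 : E.filter (fun e => e.1 ∈ R ∧ e.2 ∉ R) ⊆
        A.filter (fun e => e.1 ∈ R ∪ Y ∧ e.2 ∉ R) ∪ (F \ G) := by
      intro e he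
      simp only [mem_filter, mem_union, mem_sdiff, hA] at he ⊢
      by_cases heF : e ∈ F
      · exact Or.inr ⟨heF, fun h => hdj he.2.1 (hGY e h)⟩
      · exact Or.inl ⟨⟨he.1, heF⟩, Or.inl he.2.1, he.2.2⟩
    have h5 := (card_le_card h4).trans (card_union_le _ _)
    rw [card_sdiff_of_subset hGF, hGc] at h5
    have h6 := card_le_card hGF
    omega

/-- A `(k + 1)`-arc-strong semicomplete digraph, where `k ≤ 2`, has a spanning eulerian
subdigraph avoiding any prescribed set of `k` arcs. -/
theorem hasSpanningEulerianAvoiding [Finite V] (hD : D.IsSemicomplete) {k : ℕ} (hk2 : k ≤ 2)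
    (hk : D.IsArcStrong (k + 1)) {F : Finset (V × V)} (hF : (F : Set (V × V)) ⊆ D.arcs)
    (hne : F.Nonempty) (hFk : #F = k) : D.HasSpanningEulerianAvoiding (F : Set (V × V)) := by
  classical
  have := Fintype.ofFinite V
  obtain ⟨E, hE⟩ : ∃ E : Finset (V × V), ∀ e, e ∈ E ↔ D.Adj e.1 e.2 :=
    ⟨univ.filter fun e => D.Adj e.1 e.2, by simp⟩
  obtain ⟨A, hA⟩ : ∃ A, A = E \ F := ⟨_, rfl⟩
  have hmem : ∀ u v, (u, v) ∈ A ↔ D.Adj u v ∧ (u, v) ∉ F := by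
    intro u v
    rw [hA, mem_sdiff, hE]
  obtain ⟨a, ha⟩ := hne
  obtain ⟨b, hab⟩ : ∃ b, ∀ e ∈ F, e = a ∨ e = b := by
    by_cases h : ∃ b ∈ F, b ≠ a
    · obtain ⟨b, hb, hba⟩ := h
      refine ⟨b, fun e he => ?_⟩
      by_contra! hcon
      have h1 : #{e, a, b} ≤ #F := card_le_card (by simp [insert_subset_iff, *])
      rw [card_eq_three.2 ⟨e, a, b, hcon.1, hcon.2, hba.symm, rfl⟩] at h1
      omega
    · push Not at h
      exact ⟨a, fun e he => Or.inl (h e he)⟩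
  have hmiss : ∀ u v, u ≠ v → ¬ Adj A u v → (u, v) ∈ F ∨ (v, u) ∈ F := by
    intro u v huv h
    simp only [Adj, hmem] at h
    have := hD.adjacent u v huv
    tauto
  have hstrong : ∀ s t : V, Relation.ReflTransGen (fun u v => (u, v) ∈ A) s t := by
    intro s t
    exact (hk F hF (by omega) s t).lift id fun u v huv => (hmem u v).2 huv
  have hloop : ∀ v, (v, v) ∉ A := fun v h => hD.loopless v ((hmem v v).1 h).1
  have hnear : IsNearlySemicomplete A s(a.1, a.2) s(b.1, b.2) := by
    refine ⟨hloop, hstrong, fun u v huv => ?_, fun x y hxy hadj S hS hx hy => ?_⟩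
    · by_contra! hcon
      rcases hmiss u v huv hcon.1 with h | h <;> rcases hab _ h with rfl | rfl
      · exact hcon.2.1 rfl
      · exact hcon.2.2 rfl
      · exact hcon.2.1 Sym2.eq_swap
      · exact hcon.2.2 Sym2.eq_swap
    · -- an arc of `F` between `x` and `y` does not cross the cut
      obtain ⟨e₀, he₀, h1, h2⟩ : ∃ e₀ ∈ F, e₀.1 ∉ S ∧ e₀.2 ∉ S := by
        rcases hmiss x y hxy hadj with h | h
        · exact ⟨_, h, hx, hy⟩
        · exact ⟨_, h, hy, hx⟩
      have hc := card_erase_of_mem he₀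
      have hpos := card_pos.2 ⟨e₀, he₀⟩
      have key : ∀ (P : V × V → Prop), ¬ P e₀ → k + 1 ≤ #(E.filter P) → 2 ≤ #(A.filter P) := by
        intro P hP h3
        have h4 : E.filter P ⊆ A.filter P ∪ F.erase e₀ := by
          intro e he
          simp only [mem_filter, mem_union, mem_erase, hA, mem_sdiff] at he ⊢
          by_cases heF : e ∈ F
          · refine Or.inr ⟨?_, heF⟩
            rintro rfl
            exact hP he.2
          · exact Or.inl ⟨⟨he.1, heF⟩, he.2⟩
        have h5 := (card_le_card h4).trans (card_union_le _ _)
        omega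
      obtain ⟨t, ht⟩ := hS
      have h3 := le_card_cut hk hE ⟨t, ht⟩ hx
      have h4 := le_card_cut hk hE (S := Sᶜ) ⟨x, by simpa using hx⟩ (t := t) (by simpa using ht)
      simp only [mem_compl, not_not] at h4
      constructor
      · convert key (fun e => e.1 ∈ S ∧ e.2 ∉ S) (fun h => h1 h.1) (by convert h3)
      · convert key (fun e => e.1 ∉ S ∧ e.2 ∈ S) (fun h => h2 h.2) (by convert h4)
  have hV : ∀ v : V, ∃ w, w ≠ v := by
    intro v
    by_contra! hcon
    have h1 := hF ha
    rw [Digraph.arcs, Set.mem_ofPred_eq, hcon a.1, hcon a.2] at h1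
    exact hD.loopless v h1
  obtain ⟨H₀, hH₀⟩ := exists_isFactor hloop
    (card_le_card_cut hD hk hFk hE hA hstrong hV)
  obtain ⟨H, hH⟩ := hH₀.exists_isMaxFactor
  have : Nonempty V := ⟨a.1⟩
  refine ⟨{ Adj := fun u v => (u, v) ∈ H }, fun u v huv => ((hmem u v).1 (hH.subset huv)).1,
    isEulerian_of_conn (fun v hv => hloop v (hH.subset hv)) hH.balanced (hH.conn hnear), ?_⟩
  rw [Set.disjoint_left]
  rintro ⟨u, v⟩ huv huv'
  exact ((hmem u v).1 (hH.subset huv)).2 huv'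

/-! ### Complete digraphs and lower bounds -/

/-- A vertex without outgoing arcs is isolated in a balanced digraph. -/
lemma not_isEulerian_of_no_out [Finite V] {v w : V} (hvw : v ≠ w) (hv : ∀ t, ¬ D.Adj v t) :
    ¬ D.IsEulerian := by
  intro h
  have h1 := h.balanced v
  have h2 : {t | D.Adj v t} = ∅ := by
    ext t
    simp [hv t]
  rw [Digraph.inDeg, Digraph.outDeg, h2, Set.ncard_empty, Set.ncard_eq_zero] at h1
  obtain ⟨p⟩ := h.connected.preconnected v w
  cases p with
  | nil => exact hvw rfl
  | cons h' _ =>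
    rcases ((SimpleGraph.fromRel_adj _ _ _).1 h').2 with h3 | h3
    · exact hv _ h3
    · exact Set.eq_empty_iff_forall_notMem.1 h1 _ h3

/-- Deleting fewer than `n` arcs from the complete digraph on `n + 1` vertices leaves a strong
digraph. -/
lemma isArcStrong_complete {n : ℕ} (hV : Nat.card V = n + 1) :
    ({ Adj := fun u v => u ≠ v } : Digraph V).IsArcStrong n := by
  classical
  intro F _ hcard x y
  have : Finite V := Nat.finite_of_card_ne_zero (by omega)
  have := Fintype.ofFinite V
  rw [Nat.card_eq_fintype_card] at hV
  by_contra hxy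
  have hne : x ≠ y := by
    rintro rfl
    exact hxy Relation.ReflTransGen.refl
  -- each path `x → z → y`, and the arc from `x` to `y`, has lost an arc
  have hz : ∀ z, z ≠ x → (x, z) ∉ F → (z, y) ∈ F := by
    intro z hzx h1
    by_contra h2
    have h3 : (Digraph.deleteArcs { Adj := fun u v => u ≠ v } (F : Set (V × V))).Adj x z :=
      ⟨hzx.symm, h1⟩
    by_cases hzy : z = y
    · exact hxy (Relation.ReflTransGen.single (hzy ▸ h3))
    · exact hxy ((Relation.ReflTransGen.single h3).tail ⟨hzy, h2⟩)
  have h1 : #(univ.erase x) ≤ #F := by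
    refine card_le_card_of_injOn (fun z => if (x, z) ∈ F then (x, z) else (z, y)) ?_ ?_
    · intro z hzx
      have hzx : z ≠ x := by simpa using hzx
      dsimp only
      split_ifs with h
      · exact h
      · exact hz z hzx h
    · intro z hzx t htx hzt
      have hzx : z ≠ x := by simpa using hzx
      have htx : t ≠ x := by simpa using htx
      dsimp only at hzt
      split_ifs at hzt <;> simp only [Prod.mk.injEq] at hzt <;> grind
  rw [card_erase_of_mem (mem_univ x), card_univ, hV] at h1
  omega

/-- If all `k` arcs leaving a vertex of the complete digraph on `k + 1` vertices are to be
avoided, no spanning eulerian subdigraph is left. -/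
lemma lt_of_arcStrongForcesAvoiding {k s : ℕ} (hk : 1 ≤ k)
    (h : Digraph.ArcStrongForcesAvoiding.{u} k s) : k < s := by
  classical
  by_contra! hs
  let V := ULift.{u} (Fin (k + 1))
  let D : Digraph V := { Adj := fun u v => u ≠ v }
  let x : V := ⟨0⟩
  obtain ⟨H, hHD, hH, hdisj⟩ := h V D ⟨fun v hv => hv rfl, fun u v huv => Or.inl huv⟩
    (fun F hF hc => isArcStrong_complete (n := k) (by simp [V]) F hF (hc.trans_le hs))
    ((univ.erase x).image fun t => (x, t)) (by
      intro e he
      obtain ⟨t, ht, rfl⟩ := mem_image.1 (mem_coe.1 he)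
      exact (mem_erase.1 ht).1.symm) (by
      rw [card_image_of_injective _ (Prod.mk_right_injective x), card_erase_of_mem (mem_univ x)]
      simp [V])
  refine not_isEulerian_of_no_out (v := x) (w := ⟨Fin.last k⟩) ?_ (fun t ht => ?_) hH
  · intro h'
    have := congrArg (fun v : V => v.down.val) h'
    simp [x] at this
    omega
  · refine Set.disjoint_left.1 hdisj (show (x, t) ∈ H.arcs from ht) ?_
    have hxt : x ≠ t := hHD ht
    simpa using hxt.symm

end Digraph

end SpanningEulerian

theorem mainTheorem7 :
    (∀ (V : Type u) [Finite V] (D : Digraph V), D.IsSemicomplete → D.IsArcStrong 2 →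
      ∀ a ∈ D.arcs, D.HasSpanningEulerianAvoiding {a}) ∧
    (∀ (V : Type u) [Finite V] (D : Digraph V), D.IsSemicomplete → D.IsArcStrong 3 →
      ∀ a ∈ D.arcs, ∀ b ∈ D.arcs, a ≠ b → D.HasSpanningEulerianAvoiding {a, b}) ∧
    IsLeast {s : ℕ | Digraph.ArcStrongForcesAvoiding.{u} 1 s} 2 ∧
    IsLeast {s : ℕ | Digraph.ArcStrongForcesAvoiding.{u} 2 s} 3 := by
  classical
  have key : ∀ k, 1 ≤ k → k ≤ 2 →
      IsLeast {s : ℕ | Digraph.ArcStrongForcesAvoiding.{u} k s} (k + 1) := by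
    intro k hk hk2
    refine ⟨fun V _ D hD hs F hF hFk => ?_, fun s hs =>
      SpanningEulerian.lt_of_arcStrongForcesAvoiding hk hs⟩
    exact SpanningEulerian.hasSpanningEulerianAvoiding hD hk2 hs hF
      (Finset.card_pos.1 (by omega)) hFk
  refine ⟨fun V _ D hD hs a ha => ?_, fun V _ D hD hs a ha b hb hab => ?_,
    key 1 le_rfl one_le_two, key 2 one_le_two le_rfl⟩
  · have := (key 1 le_rfl one_le_two).1 V D hD hs {a} (by simpa using ha) (by simp)
    simpa using this
  · have := (key 2 one_le_two le_rfl).1 V D hD hs {a, b}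
      (by simpa [Set.insert_subset_iff] using ⟨ha, hb⟩) (Finset.card_pair hab)
    simpa using this
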